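/- Let $\mathbb S^2\subset\mathbb R^3$ be the unit sphere with geodesic distance $d(x,y)=\arccos\langle x,y\rangle$ and open geodesic balls $B_\varepsilon(x)$. For $N\in\mathbb N_0$ let $D_N(x,y)=\sum_{l=0}^{N}\frac{2l+1}{4\pi}P_l(\langle x,y\rangle)$, where $P_l$ is the Legendre polynomial of degree $l$, and for a finite signed Borel measure $\mu$ on $\mathbb S^2$ let $\mathcal P_N^*\mu(x)=\int_{\mathbb S^2}D_N(x,y)\,d\mu(y)$. Let $|\mu|$ denote the variation measure and $\|\mu\|_{\mathrm{TV}}=|\mu|(\mathbb S^2)$. Let $\mu^\star=\sum_{i=1}^M c_i\delta_{x_i}$ with pairwise distinct $x_i\in\mathbb S^2$ and $c_i\in\mathbb R$, and assume that $\mu^\star$ is the unique solution of $$\min_{\mu}\ \|\mu\|_{\mathrm{TV}}\quad\text{subject to}\quad \mathcal P_N^*\mu=\mathcal P_N^*\mu^\star,\tag{RP}$$ where $\mu$ ranges over all finite signed Borel measures on $\mathbb S^2$. Let $\mathcal G_n\subset\mathbb S^2$, $n\in\mathbb N$, be discrete sets whose filling distances $\rho(\mathcal G_n)=\sup_{x\in\mathbb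 S^2}\inf_{y\in\mathcal G_n}d(x,y)$ tend to $0$ (with $\rho(\emptyset)=\infty$), and consider $$\min_{\operatorname{supp}\mu\subset\mathcal G_n}\ \|\mu\|_{\mathrm{TV}}\quad\text{subject to}\quad \mathcal P_N^*\mu=\mathcal P_N^*\mu^\star.\tag{RP$_n$}$$ Then every sequence $(\mu_n)$ of finite signed Borel measures such that $\mu_n$ solves (RP$_n$) for all sufficiently large $n$ converges to $\mu^\star$ in the weak-$*$ topology, i.e. $\int f\,d\mu_n\to\int f\,d\mu^\star$ for every continuous $f:\mathbb S^2\to\mathbb R$. Moreover, there exists $\varepsilon>0$ such that for every such sequence $(\mu_n)$ $$\mu_n(B_\varepsilon(x_i))\to c_i,\qquad |\mu_n|(B_\varepsilon(x_i))\to |c_i|\qquad (i=1,\dots,M),$$ and $$|\mu_n|\Big(\big(\textstyle\bigcup_i B_\varepsilon(x_i)\big)^c\Big)\to 0 .$$ -/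

import Mathlib

open MeasureTheory Filter Topology
open scoped ENNReal

namespace SphereSuperRes

noncomputable section

/-- The unit sphere `S²` in Euclidean space `ℝ³`. -/
abbrev S2 : Type := Metric.sphere (0 : EuclideanSpace ℝ (Fin 3)) 1

/-- The geodesic (great-circle) distance `d(x, y) = arccos ⟨x, y⟩`. -/
def geoDist (x y : S2) : ℝ :=
  Real.arccos (inner ℝ (x : EuclideanSpace ℝ (Fin 3)) (y : EuclideanSpace ℝ (Fin 3)))

/-- The open geodesic ball `B_ε(x)`. -/
def geoBall (x : S2) (ε : ℝ) : Set S2 := {y | geoDist y x < ε}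

/-- The filling distance `ρ(G) = sup_x inf_{y ∈ G} d(x, y)`, with values in `[0, ∞]`
(so that the infimum over the empty set is `∞`). -/
def fillDist (G : Set S2) : ℝ≥0∞ := ⨆ x : S2, ⨅ y ∈ G, ENNReal.ofReal (geoDist x y)

/-- The Legendre polynomial `P_l`, by Rodrigues' formula
`P_l(t) = (2^l l!)⁻¹ (d/dt)^l (t² - 1)^l`. -/
def legendre (l : ℕ) : Polynomial ℝ :=
  Polynomial.C ((2 ^ l * (l.factorial : ℝ))⁻¹) *
    Polynomial.derivative^[l] ((Polynomial.X ^ 2 - 1) ^ l)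

/-- The Dirichlet kernel `D_N(x, y) = ∑_{l=0}^N (2l+1)/(4π) P_l(⟨x, y⟩)`. -/
def dirichletKernel (N : ℕ) (x y : S2) : ℝ :=
  ∑ l ∈ Finset.range (N + 1), (2 * (l : ℝ) + 1) / (4 * Real.pi) *
    (legendre l).eval
      (inner ℝ (x : EuclideanSpace ℝ (Fin 3)) (y : EuclideanSpace ℝ (Fin 3)))

/-- The low frequency information `P_N^* μ (x) = ∫ D_N(x, y) dμ(y)` of a signed measure. -/
def lowFreq (N : ℕ) (μ : SignedMeasure S2) (x : S2) : ℝ :=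
  ∫ᵛ y, dirichletKernel N x y ∂•μ

/-- The total variation norm `‖μ‖_TV = |μ|(S²)`; Mathlib's `variation` is the supremum of
`∑ |μ(B_j)|` over partitions. -/
def tvNorm (μ : SignedMeasure S2) : ℝ≥0∞ := μ.variation Set.univ

/-- The signed measures with the same low frequency information as `μ₀`. -/
def feasible (N : ℕ) (μ₀ : SignedMeasure S2) : Set (SignedMeasure S2) :=
  {μ | lowFreq N μ = lowFreq N μ₀}

/-- The feasible signed measures whose (closed) support is contained in `G`. -/
def feasibleOn (N : ℕ) (μ₀ : SignedMeasure S2) (G : Set S2) : Set (SignedMeasure S2) :=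
  {μ | μ ∈ feasible N μ₀ ∧ μ.variation.support ⊆ G}

/-- `μ` solves `min ‖μ‖_TV` subject to `P_N^* μ = P_N^* μ₀`. -/
def IsSolution (N : ℕ) (μ₀ μ : SignedMeasure S2) : Prop :=
  μ ∈ feasible N μ₀ ∧ IsMinOn tvNorm (feasible N μ₀) μ

/-- `μ` solves `min ‖μ‖_TV` over `supp μ ⊆ G`, subject to `P_N^* μ = P_N^* μ₀`. -/
def IsSolutionOn (N : ℕ) (μ₀ : SignedMeasure S2) (G : Set S2) (μ : SignedMeasure S2) : Prop :=
  μ ∈ feasibleOn N μ₀ G ∧ IsMinOn tvNorm (feasibleOn N μ₀ G) μ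

/-- Weak-* convergence of signed measures on the compact space `S²`, i.e. convergence of the
integrals of all continuous functions. -/
def WeakStarTendsto (μ : ℕ → SignedMeasure S2) (ν : SignedMeasure S2) : Prop :=
  ∀ f : C(S2, ℝ), Tendsto (fun n => ∫ᵛ x, f x ∂•(μ n)) atTop (𝓝 (∫ᵛ x, f x ∂•ν))

/-- The weighted superposition of spikes `∑ c_i δ_{x_i}`. -/
def spikes {M : ℕ} (c : Fin M → ℝ) (x : Fin M → S2) : SignedMeasure S2 :=
  ∑ i, c i • (Measure.dirac (x i)).toSignedMeasure

end

end SphereSuperRes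

/-!
The proof compares the solutions `μₙ` on the grids with `μ⋆` through compactness.

First, the minimal total variation on the grids is asymptotically at most `‖μ⋆‖`
(`exists_feasibleOn_tvNorm_le`). Moving each spike of `μ⋆` to a nearby grid point changes the low
frequency information by a vector tending to `0` in the span of the functions `D_N(·, y)`. This span
is finite-dimensional, with a basis `D_N(·, z₁), …, D_N(·, z_m)`, which stays a basis when the nodes
`z_k` are moved to grid points. Hence the error is corrected by spikes on the grid with coefficients
tending to `0` (`exists_tendsto_zero_sum_smul_eq`).

Secondly, the Jordan parts of `μₙ` thus have bounded mass, and finite measures of bounded mass on a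
compact space form a weakly compact set. If `(α, β)` is a weak limit point of the Jordan parts, then
`α - β` is feasible and `‖α - β‖ ≤ α(S²) + β(S²) ≤ ‖μ⋆‖`, so `α - β = μ⋆` by uniqueness. The
inequalities are then equalities, so no mass cancels in `α - β` and `(α, β)` is the Jordan
decomposition of `μ⋆`. Therefore both Jordan parts of `μₙ` converge weakly to those of `μ⋆`
(`tendsto_posFinite_negFinite`).

Weak-* convergence is immediate from this. For the statements on balls, the portmanteau theorem is
applied to both Jordan parts, with a radius `ε` so small that the ball about `x_i` contains no other
`x_j` in its closure; then no mass of `μ⋆` lies on the boundaries.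
-/

namespace SphereSuperRes

noncomputable section

/-! ### Jordan parts of signed measures and weak convergence -/

section SignedMeasures

variable {X : Type*} [MeasurableSpace X]

/-- The positive part of the Jordan decomposition, as an element of `FiniteMeasure X`, so that it
carries the topology of weak convergence. -/
def posFinite (s : SignedMeasure X) : FiniteMeasure X :=
  ⟨s.toJordanDecomposition.posPart, inferInstance⟩

/-- The negative part of the Jordan decomposition, as an element of `FiniteMeasure X`. -/
def negFinite (s : SignedMeasure X) : FiniteMeasure X :=
  ⟨s.toJordanDecomposition.negPart, inferInstance⟩

lemma variation_eq_posFinite_add_negFinite (s : SignedMeasure X) :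
    s.variation = (posFinite s : Measure X) + (negFinite s : Measure X) := by
  rw [← SignedMeasure.totalVariation_eq_variation]; rfl

instance isFiniteMeasure_variation (s : SignedMeasure X) : IsFiniteMeasure s.variation := by
  rw [← SignedMeasure.totalVariation_eq_variation]; infer_instance

lemma toSignedMeasure_posFinite_sub_negFinite (s : SignedMeasure X) :
    (posFinite s : Measure X).toSignedMeasure - (negFinite s : Measure X).toSignedMeasure = s :=
  s.toSignedMeasure_toJordanDecomposition

lemma variation_toSignedMeasure_sub_le (α β : Measure X) [IsFiniteMeasure α] [IsFiniteMeasure β] :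
    (α.toSignedMeasure - β.toSignedMeasure).variation ≤ α + β := by
  simpa using VectorMeasure.variation_sub_le (μ := α.toSignedMeasure) (ν := β.toSignedMeasure)

/-- If writing a signed measure as `α - β` loses no mass to cancellation, then `α` and `β` are its
Jordan parts. -/
lemma posFinite_negFinite_eq_of_mass_le {s : SignedMeasure X} {α β : FiniteMeasure X}
    (hs : (α : Measure X).toSignedMeasure - (β : Measure X).toSignedMeasure = s)
    (hmass : (α : Measure X) Set.univ + (β : Measure X) Set.univ ≤ s.variation Set.univ) :
    posFinite s = α ∧ negFinite s = β := by
  have hj : s.toJordanDecomposition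
      = Measure.jordanDecompositionOfToSignedMeasureSub (α : Measure X) (β : Measure X) := by
    rw [← hs]; exact Measure.toJordanDecomposition_toSignedMeasure_sub
  have hpos : (posFinite s : Measure X) = α - β := by
    change s.toJordanDecomposition.posPart = _
    rw [hj]; rfl
  have hneg : (negFinite s : Measure X) = β - α := by
    change s.toJordanDecomposition.negPart = _
    rw [hj]; rfl
  have hpα : (posFinite s : Measure X) ≤ α := hpos ▸ Measure.sub_le
  have hnβ : (negFinite s : Measure X) ≤ β := hneg ▸ Measure.sub_le
  rw [variation_eq_posFinite_add_negFinite, Measure.add_apply] at hmass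
  have h1 := hpα Set.univ
  have h2 := hnβ Set.univ
  have hα := measure_ne_top (α : Measure X) Set.univ
  have hβ := measure_ne_top (β : Measure X) Set.univ
  have hp := measure_ne_top (posFinite s : Measure X) Set.univ
  have hn := measure_ne_top (negFinite s : Measure X) Set.univ
  have key : (posFinite s : Measure X) Set.univ = (α : Measure X) Set.univ ∧
      (negFinite s : Measure X) Set.univ = (β : Measure X) Set.univ := by
    lift (α : Measure X) Set.univ to NNReal using hα with a
    lift (β : Measure X) Set.univ to NNReal using hβ with b
    lift (posFinite s : Measure X) Set.univ to NNReal using hp with p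
    lift (negFinite s : Measure X) Set.univ to NNReal using hn with q
    norm_cast at *
    rw [← NNReal.coe_le_coe] at *
    rw [← NNReal.coe_inj, ← NNReal.coe_inj]
    push_cast at *
    constructor <;> linarith
  have hpα' : (posFinite s : Measure X) = α := Measure.eq_of_le_of_measure_univ_eq hpα key.1
  have hnβ' : (negFinite s : Measure X) = β := Measure.eq_of_le_of_measure_univ_eq hnβ key.2
  exact ⟨Subtype.ext hpα', Subtype.ext hnβ'⟩

variable [TopologicalSpace X] [BorelSpace X]

lemma integrable_of_continuous [CompactSpace X] (μ : Measure X) [IsFiniteMeasure μ]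
    (f : C(X, ℝ)) : Integrable f μ :=
  (BoundedContinuousFunction.mkOfCompact f).integrable μ

lemma integral_toSignedMeasure_sub [CompactSpace X] (α β : Measure X) [IsFiniteMeasure α]
    [IsFiniteMeasure β] (f : C(X, ℝ)) :
    ∫ᵛ x, f x ∂•(α.toSignedMeasure - β.toSignedMeasure) = ∫ x, f x ∂α - ∫ x, f x ∂β := by
  have hflip : (ContinuousLinearMap.lsmul ℝ ℝ : ℝ →L[ℝ] ℝ →L[ℝ] ℝ)
      = (ContinuousLinearMap.lsmul ℝ ℝ).flip := by
    ext; simp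
  rw [VectorMeasure.integral_sub_vectorMeasure (integrable_of_continuous _ f)
    (integrable_of_continuous _ f), hflip, VectorMeasure.integral_toSignedMeasure,
    VectorMeasure.integral_toSignedMeasure]

lemma integral_eq_posFinite_sub_negFinite [CompactSpace X] (s : SignedMeasure X) (f : C(X, ℝ)) :
    ∫ᵛ x, f x ∂•s
      = ∫ x, f x ∂(posFinite s : Measure X) - ∫ x, f x ∂(negFinite s : Measure X) := by
  rw [← integral_toSignedMeasure_sub, toSignedMeasure_posFinite_sub_negFinite]

/-- Suppose that `t` is the only signed measure of total variation at most that of `t` with given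
integrals against a family `K` of continuous functions. Then along any family of signed measures
whose `K`-integrals converge to those of `t`, and whose total variations are asymptotically at most
that of `t`, the Jordan parts converge weakly to those of `t`. -/
theorem tendsto_posFinite_negFinite [CompactSpace X] [T2Space X] {ι : Type*} {F : Filter ι}
    {s : ι → SignedMeasure X} {t : SignedMeasure X} (K : Set C(X, ℝ))
    (hK : ∀ f ∈ K, Tendsto (fun i => ∫ᵛ x, f x ∂•(s i)) F (𝓝 (∫ᵛ x, f x ∂•t)))
    (hmass : ∀ r : ℝ≥0∞, t.variation Set.univ < r → ∀ᶠ i in F, (s i).variation Set.univ ≤ r)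
    (huniq : ∀ ν : SignedMeasure X, (∀ f ∈ K, ∫ᵛ x, f x ∂•ν = ∫ᵛ x, f x ∂•t) →
      ν.variation Set.univ ≤ t.variation Set.univ → ν = t) :
    Tendsto (fun i => posFinite (s i)) F (𝓝 (posFinite t)) ∧
      Tendsto (fun i => negFinite (s i)) F (𝓝 (negFinite t)) := by
  obtain ⟨C, hC⟩ : ∃ C : NNReal, t.variation Set.univ < C :=
    ENNReal.lt_iff_exists_nnreal_btwn.1 (measure_lt_top t.variation Set.univ) |>.imp fun _ h => h.1
  have hcpt := isCompact_setOfPred_finiteMeasure_le_of_compactSpace X C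
  have hbound := hmass C hC
  have hpos_mass : ∀ᶠ i in F, (posFinite (s i)).mass ≤ C := by
    filter_upwards [hbound] with i hi
    rw [variation_eq_posFinite_add_negFinite, Measure.add_apply] at hi
    rw [← ENNReal.coe_le_coe, FiniteMeasure.ennreal_mass]
    exact le_self_add.trans hi
  have hneg_mass : ∀ᶠ i in F, (negFinite (s i)).mass ≤ C := by
    filter_upwards [hbound] with i hi
    rw [variation_eq_posFinite_add_negFinite, Measure.add_apply] at hi
    rw [← ENNReal.coe_le_coe, FiniteMeasure.ennreal_mass]
    exact le_add_self.trans hi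
  -- By compactness it suffices to identify the limits along ultrafilters.
  have key : ∀ U : Ultrafilter ι, ↑U ≤ F →
      Tendsto (fun i => posFinite (s i)) U (𝓝 (posFinite t)) ∧
        Tendsto (fun i => negFinite (s i)) U (𝓝 (negFinite t)) := by
    intro U hU
    obtain ⟨α, -, hα⟩ := hcpt.ultrafilter_le_nhds' (U.map fun i => posFinite (s i))
      (hU hpos_mass)
    obtain ⟨β, -, hβ⟩ := hcpt.ultrafilter_le_nhds' (U.map fun i => negFinite (s i))
      (hU hneg_mass)
    replace hα : Tendsto (fun i => posFinite (s i)) U (𝓝 α) := hα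
    replace hβ : Tendsto (fun i => negFinite (s i)) U (𝓝 β) := hβ
    have hle : (α : Measure X) Set.univ + (β : Measure X) Set.univ ≤ t.variation Set.univ := by
      have hlim : Tendsto (fun i => (s i).variation Set.univ) U
          (𝓝 ((α : Measure X) Set.univ + (β : Measure X) Set.univ)) := by
        simp_rw [variation_eq_posFinite_add_negFinite, Measure.add_apply,
          ← FiniteMeasure.ennreal_mass]
        exact (ENNReal.tendsto_coe.2 hα.mass).add (ENNReal.tendsto_coe.2 hβ.mass)
      exact le_of_forall_gt_imp_ge_of_dense fun r hr => le_of_tendsto hlim (hU (hmass r hr))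
    have heq : (α : Measure X).toSignedMeasure - (β : Measure X).toSignedMeasure = t := by
      refine huniq _ (fun f hf => ?_)
        ((variation_toSignedMeasure_sub_le (α : Measure X) (β : Measure X) Set.univ).trans hle)
      rw [integral_toSignedMeasure_sub]
      refine tendsto_nhds_unique ?_ ((hK f hf).mono_left hU)
      simp_rw [integral_eq_posFinite_sub_negFinite]
      exact (FiniteMeasure.tendsto_iff_forall_integral_tendsto.1 hα
        (BoundedContinuousFunction.mkOfCompact f)).sub
        (FiniteMeasure.tendsto_iff_forall_integral_tendsto.1 hβ
        (BoundedContinuousFunction.mkOfCompact f))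
    obtain ⟨rfl, rfl⟩ := posFinite_negFinite_eq_of_mass_le heq hle
    exact ⟨hα, hβ⟩
  exact ⟨tendsto_iff_ultrafilter _ _ _ |>.2 fun U hU => (key U hU).1,
    tendsto_iff_ultrafilter _ _ _ |>.2 fun U hU => (key U hU).2⟩

/-- The portmanteau theorem for finite measures, on sets whose frontier is null for the limit. -/
lemma tendsto_measure_of_null_frontier_of_tendsto [HasOuterApproxClosed X] {ι : Type*}
    {F : Filter ι} {ρ : ι → FiniteMeasure X} {σ : FiniteMeasure X} (h : Tendsto ρ F (𝓝 σ))
    {E : Set X} (hE : (σ : Measure X) (frontier E) = 0) :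
    Tendsto (fun i => (ρ i : Measure X) E) F (𝓝 ((σ : Measure X) E)) := by
  refine tendsto_measure_of_le_liminf_measure_of_limsup_measure_le interior_subset subset_closure
    hE ?_ (FiniteMeasure.limsup_measure_closed_le_of_tendsto h isClosed_closure)
  rcases F.eq_or_neBot with rfl | hF
  · simp
  -- The open case follows from the closed one, since the total masses converge.
  have hmass : Tendsto (fun i => (ρ i : Measure X) Set.univ) F (𝓝 ((σ : Measure X) Set.univ)) := by
    simp_rw [← FiniteMeasure.ennreal_mass]
    exact ENNReal.tendsto_coe.2 h.mass
  have hclosed := FiniteMeasure.limsup_measure_closed_le_of_tendsto h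
    (isOpen_interior (s := E)).isClosed_compl
  have hadd : ∀ τ : FiniteMeasure X, (τ : Measure X) Set.univ
      = (τ : Measure X) (interior E) + (τ : Measure X) (interior E)ᶜ := fun τ =>
    (measure_add_measure_compl isOpen_interior.measurableSet).symm
  refine le_of_forall_lt_imp_le_of_dense fun r hr => le_liminf_of_le (by isBoundedDefault) ?_
  obtain ⟨δ, hδ, hrδ⟩ := ENNReal.lt_iff_exists_add_pos_lt.1 hr
  have hfin := measure_ne_top (σ : Measure X) (interior E)ᶜ
  have hlt : r + ((σ : Measure X) (interior E)ᶜ + δ) < (σ : Measure X) Set.univ := by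
    rw [hadd, add_comm _ (δ : ℝ≥0∞), ← add_assoc]
    exact ENNReal.add_lt_add_right hfin hrδ
  have hlt' : limsup (fun i => (ρ i : Measure X) (interior E)ᶜ) F
      < (σ : Measure X) (interior E)ᶜ + δ :=
    hclosed.trans_lt (ENNReal.lt_add_right hfin (by exact_mod_cast hδ.ne'))
  filter_upwards [hmass.eventually_const_lt hlt, eventually_lt_of_limsup_lt hlt'] with i h1 h2
  by_contra! h3
  rw [hadd] at h1
  exact absurd h1 (add_le_add h3.le h2.le).not_gt

end SignedMeasures

/-! ### Perturbing spanning families -/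

/-- If `Φ` spans a finite-dimensional space and the sets `G n` become dense, then small elements of
the span are combinations, with small coefficients, of boundedly many values of `Φ` on `G n`: a
basis of the span taken from the values of `Φ` stays a basis after a slight displacement of the
nodes, and the coordinates depend continuously on the nodes. -/
theorem exists_tendsto_zero_sum_smul_eq {X V : Type*} [TopologicalSpace X] [AddCommGroup V]
    [Module ℝ V] [TopologicalSpace V] [IsTopologicalAddGroup V] [ContinuousSMul ℝ V] [T2Space V]
    {Φ : X → V} (hΦ : Continuous Φ) [FiniteDimensional ℝ (Submodule.span ℝ (Set.range Φ))]
    {G : ℕ → Set X}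
    (hG : ∀ x, ∃ y : ℕ → X, Tendsto y atTop (𝓝 x) ∧ ∀ᶠ n in atTop, y n ∈ G n)
    {w : ℕ → V} (hw : ∀ n, w n ∈ Submodule.span ℝ (Set.range Φ)) (hw0 : Tendsto w atTop (𝓝 0)) :
    ∃ (m : ℕ) (z : ℕ → Fin m → X) (a : ℕ → Fin m → ℝ),
      (∀ᶠ n in atTop, ∀ k, z n k ∈ G n) ∧ (∀ᶠ n in atTop, ∑ k, a n k • Φ (z n k) = w n) ∧
        Tendsto a atTop (𝓝 0) := by
  set W := Submodule.span ℝ (Set.range Φ) with hW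
  obtain ⟨f, hf, hspan, hli⟩ := Submodule.exists_fun_fin_finrank_span_eq ℝ (Set.range Φ)
  choose z₀ hz₀ using hf
  let Ψ : X → W := fun x => ⟨Φ x, Submodule.subset_span ⟨x, rfl⟩⟩
  have hΨ : Continuous Ψ := hΦ.subtype_mk _
  let b : Module.Basis _ ℝ W := (Module.Basis.span hli).map (LinearEquiv.ofEq _ _ hspan)
  have hb : ∀ k, b k = Ψ (z₀ k) := fun k => Subtype.ext (by simp [b, Ψ, hz₀, Module.Basis.span_apply])
  have hrepr : Continuous b.equivFun :=
    LinearMap.continuous_of_finiteDimensional b.equivFun.toLinearMap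
  choose z hz hzG using fun k => hG (z₀ k)
  let M : ℕ → Matrix (Fin (Module.finrank ℝ W)) (Fin (Module.finrank ℝ W)) ℝ :=
    fun n => Matrix.of fun j k => b.equivFun (Ψ (z k n)) j
  have hM : Tendsto M atTop (𝓝 1) := by
    refine tendsto_pi_nhds.2 fun j => tendsto_pi_nhds.2 fun k => ?_
    have h1 : b.equivFun (Ψ (z₀ k)) j = (1 : Matrix _ _ ℝ) j k := by
      rw [← hb, Module.Basis.equivFun_self, Matrix.one_apply]
      simp [eq_comm]
    rw [← h1]
    exact (((continuous_apply j).comp (hrepr.comp hΨ)).tendsto (z₀ k)).comp (hz k)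
  have hdet : ∀ᶠ n in atTop, (M n).det ≠ 0 :=
    ((continuous_id.matrix_det.tendsto 1).comp hM).eventually_ne (by simp)
  have hinv : Tendsto (fun n => (M n)⁻¹) atTop (𝓝 1) := by
    have := (continuousAt_matrix_inv (1 : Matrix (Fin (Module.finrank ℝ W)) _ ℝ)
      (by simp)).tendsto
    rw [inv_one] at this
    exact this.comp hM
  let c : ℕ → Fin (Module.finrank ℝ W) → ℝ := fun n => b.equivFun ⟨w n, hw n⟩
  have hc : Tendsto c atTop (𝓝 0) := by
    have h0 : Tendsto (fun n => (⟨w n, hw n⟩ : W)) atTop (𝓝 0) := by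
      rw [tendsto_subtype_rng]; exact hw0
    have := (hrepr.tendsto 0).comp h0
    rwa [map_zero] at this
  refine ⟨_, fun n k => z k n, fun n => (M n)⁻¹.mulVec (c n), eventually_all.2 hzG, ?_, ?_⟩
  · filter_upwards [hdet] with n hn
    set a := (M n)⁻¹.mulVec (c n) with ha
    have hsum : ∑ k, a k • Ψ (z k n) = ⟨w n, hw n⟩ := by
      apply b.equivFun.injective
      change _ = c n
      have : c n = (M n).mulVec a := by
        rw [ha, Matrix.mulVec_mulVec, Matrix.mul_nonsing_inv _ (isUnit_iff_ne_zero.2 hn),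
          Matrix.one_mulVec]
      rw [this, map_sum]
      ext j
      simp only [Finset.sum_apply, map_smul, Pi.smul_apply, smul_eq_mul, Matrix.mulVec,
        dotProduct, M, Matrix.of_apply]
      exact Finset.sum_congr rfl fun k _ => mul_comm _ _
    have := congrArg Subtype.val hsum
    simpa [Ψ] using this
  · have hcont : Continuous fun p : Matrix (Fin (Module.finrank ℝ W)) (Fin (Module.finrank ℝ W)) ℝ
        × (Fin (Module.finrank ℝ W) → ℝ) => p.1.mulVec p.2 :=
      continuous_fst.matrix_mulVec continuous_snd
    have := (hcont.tendsto (1, 0)).comp (hinv.prodMk_nhds hc)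
    rwa [Matrix.mulVec_zero] at this

/-! ### The Dirichlet kernel -/

lemma dirichletKernel_eq_eval (N : ℕ) : ∃ q : Polynomial ℝ, ∀ x y : S2, dirichletKernel N x y =
    q.eval (inner ℝ (x : EuclideanSpace ℝ (Fin 3)) (y : EuclideanSpace ℝ (Fin 3))) :=
  ⟨∑ l ∈ Finset.range (N + 1),
    Polynomial.C ((2 * (l : ℝ) + 1) / (4 * Real.pi)) * legendre l, fun x y => by
      simp [dirichletKernel, Polynomial.eval_finsetSum]⟩

lemma continuous_dirichletKernel (N : ℕ) (x : S2) : Continuous fun y => dirichletKernel N x y := by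
  obtain ⟨q, hq⟩ := dirichletKernel_eq_eval N
  simp_rw [hq]
  exact q.continuous.comp (by fun_prop)

/-- The functions `D_N(·, y)` lie in the span of finitely many monomials, as one sees by expanding
the powers of the inner product. -/
instance finiteDimensional_span_dirichletKernel (N : ℕ) : FiniteDimensional ℝ
    (Submodule.span ℝ (Set.range fun y x : S2 => dirichletKernel N x y)) := by
  obtain ⟨q, hq⟩ := dirichletKernel_eq_eval N
  -- A monomial of degree `d` is indexed by a word of length `d` in the three coordinates.
  let mono : (Σ d : Fin (q.natDegree + 1), Fin (d : ℕ) → Fin 3) → S2 → ℝ := fun p x =>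
    ∏ j, (x : EuclideanSpace ℝ (Fin 3)) (p.2 j)
  have hpow : ∀ (d : Fin (q.natDegree + 1)) (y : S2), (fun x : S2 =>
      (inner ℝ (x : EuclideanSpace ℝ (Fin 3)) (y : EuclideanSpace ℝ (Fin 3))) ^ (d : ℕ)) ∈
      Submodule.span ℝ (Set.range mono) := by
    intro d y
    have : (fun x : S2 =>
        (inner ℝ (x : EuclideanSpace ℝ (Fin 3)) (y : EuclideanSpace ℝ (Fin 3))) ^ (d : ℕ)) =
        ∑ p : Fin (d : ℕ) → Fin 3,
          (∏ j, (y : EuclideanSpace ℝ (Fin 3)) (p j)) • mono ⟨d, p⟩ := by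
      ext x
      simp only [PiLp.inner_apply, Fintype.sum_pow, Finset.sum_apply, Pi.smul_apply, mono,
        smul_eq_mul, ← Finset.prod_mul_distrib]
      simp
    rw [this]
    exact Submodule.sum_mem _ fun p _ =>
      Submodule.smul_mem _ _ (Submodule.subset_span ⟨_, rfl⟩)
  have hle : Submodule.span ℝ (Set.range fun y x : S2 => dirichletKernel N x y) ≤
      Submodule.span ℝ (Set.range mono) := by
    rw [Submodule.span_le]
    rintro _ ⟨y, rfl⟩
    have : (fun x : S2 => dirichletKernel N x y) = ∑ d : Fin (q.natDegree + 1),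
        q.coeff d • fun x : S2 =>
          (inner ℝ (x : EuclideanSpace ℝ (Fin 3)) (y : EuclideanSpace ℝ (Fin 3))) ^ (d : ℕ) := by
      ext x
      rw [hq, Polynomial.eval_eq_sum_range, Finset.sum_range]
      simp [Finset.sum_apply]
    change (fun x : S2 => dirichletKernel N x y) ∈ Submodule.span ℝ (Set.range mono)
    rw [this]
    exact Submodule.sum_mem _ fun d _ => Submodule.smul_mem _ _ (hpow d y)
  have : FiniteDimensional ℝ (Submodule.span ℝ (Set.range mono)) :=
    FiniteDimensional.span_of_finite ℝ (Set.finite_range mono)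
  exact Submodule.finiteDimensional_of_le hle

/-- The kernel `D_N(x, ·)` as a continuous function. -/
def dirichletKernelMap (N : ℕ) (x : S2) : C(S2, ℝ) :=
  ⟨fun y => dirichletKernel N x y, continuous_dirichletKernel N x⟩

lemma lowFreq_apply (N : ℕ) (μ : SignedMeasure S2) (x : S2) :
    lowFreq N μ x = ∫ᵛ y, dirichletKernelMap N x y ∂•μ := rfl

lemma lowFreq_add (N : ℕ) (μ ν : SignedMeasure S2) :
    lowFreq N (μ + ν) = lowFreq N μ + lowFreq N ν := by
  ext x
  exact VectorMeasure.integral_add_vectorMeasure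
    (integrable_of_continuous _ (dirichletKernelMap N x))
    (integrable_of_continuous _ (dirichletKernelMap N x))

/-! ### Superpositions of spikes -/

lemma integral_spikes {M : ℕ} (c : Fin M → ℝ) (x : Fin M → S2) (f : C(S2, ℝ)) :
    ∫ᵛ y, f y ∂•(spikes c x) = ∑ i, c i * f (x i) := by
  unfold spikes
  rw [VectorMeasure.integral_finsetSum_vectorMeasure
    fun i _ => integrable_of_continuous _ f]
  refine Finset.sum_congr rfl fun i _ => ?_
  have := integral_toSignedMeasure_sub (Measure.dirac (x i)) 0 f
  rw [Measure.toSignedMeasure_zero, sub_zero] at this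
  rw [VectorMeasure.integral_smul_vectorMeasure, this]
  simp

lemma lowFreq_spikes (N : ℕ) {M : ℕ} (c : Fin M → ℝ) (x : Fin M → S2) :
    lowFreq N (spikes c x) = ∑ i, c i • fun z => dirichletKernel N z (x i) := by
  ext z
  rw [lowFreq_apply, integral_spikes]
  simp [dirichletKernelMap]

lemma variation_spikes_le {M : ℕ} (c : Fin M → ℝ) (x : Fin M → S2) :
    (spikes c x).variation ≤ ∑ i, ‖c i‖ₑ • Measure.dirac (x i) := by
  refine (VectorMeasure.variation_finsetSum_le _ _).trans
    (Finset.sum_le_sum fun i _ => ?_)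
  rw [VectorMeasure.variation_smul, Measure.variation_toSignedMeasure]
  exact le_of_eq (by ext s hs; simp [enorm_eq_nnnorm])

lemma tvNorm_spikes_le {M : ℕ} (c : Fin M → ℝ) (x : Fin M → S2) :
    tvNorm (spikes c x) ≤ ∑ i, ‖c i‖ₑ :=
  (variation_spikes_le c x Set.univ).trans (by simp)

open Classical in
lemma spikes_apply {M : ℕ} (c : Fin M → ℝ) (x : Fin M → S2) {E : Set S2} (hE : MeasurableSet E) :
    spikes c x E = ∑ i, if x i ∈ E then c i else 0 := by
  have : ∀ i, (Measure.dirac (x i)).toSignedMeasure E = if x i ∈ E then (1 : ℝ) else 0 := by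
    intro i
    rw [Measure.toSignedMeasure_apply_measurable hE, Measure.real, Measure.dirac_apply' _ hE]
    by_cases h : x i ∈ E <;> simp [h]
  simp [spikes, this]

/-- No mass cancels between spikes at distinct points. -/
lemma variation_spikes {M : ℕ} (c : Fin M → ℝ) {x : Fin M → S2} (hx : Function.Injective x) :
    (spikes c x).variation = ∑ i, ‖c i‖ₑ • Measure.dirac (x i) := by
  classical
  refine le_antisymm (variation_spikes_le c x) (Measure.le_iff.2 fun s hs => ?_)
  have hsub : ⋃ i ∈ Finset.univ.filter (fun i => x i ∈ s), {x i} ⊆ s := by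
    intro y hy
    simp only [Set.mem_iUnion, Finset.mem_filter, Set.mem_singleton_iff] at hy
    obtain ⟨i, hi, rfl⟩ := hy
    exact hi.2
  calc (∑ i, ‖c i‖ₑ • Measure.dirac (x i)) s
      = ∑ i ∈ Finset.univ.filter (fun i => x i ∈ s), ‖c i‖ₑ := by
        simp [Measure.finsetSum_apply, hs, Set.indicator_apply, Finset.sum_filter]
    _ ≤ ∑ i ∈ Finset.univ.filter (fun i => x i ∈ s), (spikes c x).variation {x i} := by
        refine Finset.sum_le_sum fun i _ => ?_
        have : spikes c x {x i} = c i := by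
          simp [spikes_apply c x (measurableSet_singleton _), hx.eq_iff]
        rw [← this]
        exact VectorMeasure.enorm_measure_le_variation _ _
    _ = (spikes c x).variation (⋃ i ∈ Finset.univ.filter (fun i => x i ∈ s), {x i}) := by
        refine (measure_biUnion_finset ?_ fun i _ => measurableSet_singleton _).symm
        intro i _ j _ hij
        simpa using hx.ne hij
    _ ≤ (spikes c x).variation s := measure_mono hsub

lemma support_variation_spikes_subset {M : ℕ} (c : Fin M → ℝ) (x : Fin M → S2) :
    (spikes c x).variation.support ⊆ Set.range x := by
  refine Measure.support_subset_of_isClosed (Set.finite_range x).isClosed ?_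
  rw [mem_ae_iff]
  refine le_antisymm ((variation_spikes_le c x _).trans ?_) zero_le
  simp [Measure.finsetSum_apply, (Set.finite_range x).measurableSet.compl]

/-! ### Recovery on fine grids -/

lemma exists_tendsto_of_tendsto_fillDist {G : ℕ → Set S2}
    (hfill : Tendsto (fun n => fillDist (G n)) atTop (𝓝 0)) (x : S2) :
    ∃ y : ℕ → S2, Tendsto y atTop (𝓝 x) ∧ ∀ᶠ n in atTop, y n ∈ G n := by
  classical
  -- The infimum defining the filling distance need not be attained, hence the slack `1 / (n + 1)`.
  have hex : ∀ n, fillDist (G n) ≠ ⊤ →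
      ∃ y ∈ G n, ENNReal.ofReal (geoDist x y) < fillDist (G n) + ((n : ℝ≥0∞) + 1)⁻¹ := by
    intro n hn
    have hlt : ⨅ y ∈ G n, ENNReal.ofReal (geoDist x y) < fillDist (G n) + ((n : ℝ≥0∞) + 1)⁻¹ :=
      (le_iSup (fun x : S2 => ⨅ y ∈ G n, ENNReal.ofReal (geoDist x y)) x).trans_lt
        (ENNReal.lt_add_right hn (by simp))
    simpa [iInf_lt_iff] using hlt
  have hfin : ∀ᶠ n in atTop, fillDist (G n) ≠ ⊤ :=
    (hfill.eventually_lt_const ENNReal.zero_lt_top).mono fun n hn => hn.ne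
  let y : ℕ → S2 := fun n => if hn : fillDist (G n) ≠ ⊤ then (hex n hn).choose else x
  have hy : ∀ᶠ n in atTop, y n ∈ G n ∧
      ENNReal.ofReal (geoDist x (y n)) < fillDist (G n) + ((n : ℝ≥0∞) + 1)⁻¹ := by
    filter_upwards [hfin] with n hn
    simp only [y, dif_pos hn]
    exact (hex n hn).choose_spec
  refine ⟨y, ?_, hy.mono fun _ h => h.1⟩
  have hbound : Tendsto (fun n => fillDist (G n) + ((n : ℝ≥0∞) + 1)⁻¹) atTop (𝓝 0) := by
    have : Tendsto (fun n : ℕ => ((n : ℝ≥0∞) + 1)⁻¹) atTop (𝓝 0) := by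
      have := (tendsto_add_atTop_iff_nat 1).2 ENNReal.tendsto_inv_nat_nhds_zero
      simpa using this
    simpa using hfill.add this
  have hgeo : Tendsto (fun n => geoDist x (y n)) atTop (𝓝 0) := by
    have h0 : Tendsto (fun n => ENNReal.ofReal (geoDist x (y n))) atTop (𝓝 0) :=
      tendsto_of_tendsto_of_tendsto_of_le_of_le' tendsto_const_nhds hbound
        (Eventually.of_forall fun _ => zero_le) (hy.mono fun _ h => h.2.le)
    have := (ENNReal.tendsto_toReal ENNReal.zero_ne_top).comp h0
    simpa [Function.comp_def, ENNReal.toReal_ofReal (Real.arccos_nonneg _), geoDist] using this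
  have hinner : Tendsto (fun n => inner ℝ (x : EuclideanSpace ℝ (Fin 3)) (y n)) atTop (𝓝 1) := by
    have := (Real.continuous_cos.tendsto 0).comp hgeo
    rw [Real.cos_zero] at this
    refine this.congr fun n => ?_
    have h := abs_le.1 (abs_real_inner_le_norm (x : EuclideanSpace ℝ (Fin 3)) (y n))
    simp only [norm_eq_of_mem_sphere, mul_one] at h
    exact Real.cos_arccos h.1 h.2
  rw [tendsto_subtype_rng, tendsto_iff_norm_sub_tendsto_zero]
  -- On the unit sphere, `‖y - x‖² = 2 - 2⟨x, y⟩`.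
  have hsq : Tendsto (fun n => ‖(y n : EuclideanSpace ℝ (Fin 3)) - x‖ ^ 2) atTop (𝓝 0) := by
    have := (hinner.const_mul 2).const_sub 2
    rw [mul_one, sub_self] at this
    refine this.congr fun n => ?_
    rw [norm_sub_sq_real, real_inner_comm]
    simp only [norm_eq_of_mem_sphere]
    ring
  have := hsq.sqrt
  simpa [Real.sqrt_sq] using this

/-- On fine grids, the spikes can be moved to grid points and corrected by small spikes on the grid
so as to become feasible; so the minimal total variation on the grid is asymptotically at most
`∑ |c i|`. -/
theorem exists_feasibleOn_tvNorm_le (N : ℕ) {M : ℕ} (c : Fin M → ℝ) (x : Fin M → S2)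
    {G : ℕ → Set S2} (hfill : Tendsto (fun n => fillDist (G n)) atTop (𝓝 0)) {r : ℝ≥0∞}
    (hr : ∑ i, ‖c i‖ₑ < r) :
    ∀ᶠ n in atTop, ∃ ν ∈ feasibleOn N (spikes c x) (G n), tvNorm ν ≤ r := by
  have hG := exists_tendsto_of_tendsto_fillDist hfill
  let Φ : S2 → S2 → ℝ := fun y z => dirichletKernel N z y
  have hΦ : Continuous Φ := continuous_pi fun z => continuous_dirichletKernel N z
  choose y hy hyG using fun i => hG (x i)
  let w : ℕ → S2 → ℝ := fun n => ∑ i, c i • (Φ (x i) - Φ (y i n))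
  have hw : ∀ n, w n ∈ Submodule.span ℝ (Set.range Φ) := fun n =>
    Submodule.sum_mem _ fun i _ => Submodule.smul_mem _ _ <| Submodule.sub_mem _
      (Submodule.subset_span ⟨_, rfl⟩) (Submodule.subset_span ⟨_, rfl⟩)
  have hw0 : Tendsto w atTop (𝓝 0) := by
    have : Tendsto w atTop (𝓝 (∑ i, c i • (Φ (x i) - Φ (x i)))) :=
      tendsto_finsetSum _ fun i _ =>
        (tendsto_const_nhds.sub ((hΦ.tendsto (x i)).comp (hy i))).const_smul (c i)
    simpa using this
  have : FiniteDimensional ℝ (Submodule.span ℝ (Set.range Φ)) :=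
    finiteDimensional_span_dirichletKernel N
  obtain ⟨m, z, a, hzG, hsum, ha⟩ := exists_tendsto_zero_sum_smul_eq hΦ hG hw hw0
  have hnorm : Tendsto (fun n => ∑ i, ‖c i‖ₑ + ∑ k, ‖a n k‖ₑ) atTop (𝓝 (∑ i, ‖c i‖ₑ)) := by
    have h0 : Tendsto (fun n => ∑ k, ‖a n k‖ₑ) atTop (𝓝 (∑ _k : Fin m, ‖(0 : ℝ)‖ₑ)) :=
      tendsto_finsetSum _ fun k _ => (tendsto_pi_nhds.1 ha k).enorm
    simpa using h0.const_add (∑ i, ‖c i‖ₑ)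
  filter_upwards [hzG, hsum, eventually_all.2 hyG, hnorm.eventually_lt_const hr]
    with n hzn hsn hyn hrn
  have hvar : (spikes c (fun i => y i n) + spikes (a n) (z n)).variation ≤
      (spikes c fun i => y i n).variation + (spikes (a n) (z n)).variation :=
    VectorMeasure.variation_add_le
  refine ⟨spikes c (fun i => y i n) + spikes (a n) (z n), ⟨?_, ?_⟩, ?_⟩
  · change lowFreq N _ = lowFreq N _
    have hsn' : ∑ k, a n k • (fun t => dirichletKernel N t (z n k)) = w n := hsn
    rw [lowFreq_add, lowFreq_spikes, lowFreq_spikes, lowFreq_spikes, hsn']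
    simp only [w, Φ, smul_sub, Finset.sum_sub_distrib]
    abel
  · refine (Measure.support_mono hvar).trans ?_
    rw [Measure.support_add]
    refine Set.union_subset ((support_variation_spikes_subset _ _).trans ?_)
      ((support_variation_spikes_subset _ _).trans ?_)
    · rintro _ ⟨i, rfl⟩; exact hyn i
    · rintro _ ⟨k, rfl⟩; exact hzn k
  · refine le_trans ?_ hrn.le
    refine (hvar Set.univ).trans ?_
    rw [Measure.add_apply]
    exact add_le_add (tvNorm_spikes_le _ _) (tvNorm_spikes_le _ _)

/-- The Jordan parts of the solutions on the grids converge weakly to those of the spikes. -/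
theorem tendsto_jordan_of_isSolutionOn {N M : ℕ} {c : Fin M → ℝ} {x : Fin M → S2}
    (hx : Function.Injective x) (hsol : IsSolution N (spikes c x) (spikes c x))
    (huniq : ∀ ν, IsSolution N (spikes c x) ν → ν = spikes c x) {G : ℕ → Set S2}
    (hfill : Tendsto (fun n => fillDist (G n)) atTop (𝓝 0)) {μ : ℕ → SignedMeasure S2}
    (hμ : ∀ᶠ n in atTop, IsSolutionOn N (spikes c x) (G n) (μ n)) :
    Tendsto (fun n => posFinite (μ n)) atTop (𝓝 (posFinite (spikes c x))) ∧
      Tendsto (fun n => negFinite (μ n)) atTop (𝓝 (negFinite (spikes c x))) := by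
  refine tendsto_posFinite_negFinite (Set.range (dirichletKernelMap N)) ?_ ?_ ?_
  · rintro _ ⟨z, rfl⟩
    refine tendsto_const_nhds.congr' ?_
    filter_upwards [hμ] with n hn
    rw [← lowFreq_apply, ← lowFreq_apply]
    exact (congrFun hn.1.1 z).symm
  · intro r hr
    have hr' : ∑ i, ‖c i‖ₑ < r := by
      simpa [variation_spikes c hx, Measure.finsetSum_apply] using hr
    filter_upwards [hμ, exists_feasibleOn_tvNorm_le N c x hfill hr'] with n hn ⟨ν, hν, hνr⟩
    exact (isMinOn_iff.1 hn.2 ν hν).trans hνr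
  · intro ν hν hle
    refine huniq ν ⟨funext fun z => ?_, isMinOn_iff.2 fun ν' hν' => ?_⟩
    · rw [lowFreq_apply, lowFreq_apply]
      exact hν _ ⟨z, rfl⟩
    · exact le_trans hle (isMinOn_iff.1 hsol.2 ν' hν')

/-! ### Geodesic balls -/

lemma continuous_geoDist (x : S2) : Continuous fun y => geoDist y x :=
  Real.continuous_arccos.comp (by fun_prop)

lemma geoDist_self (x : S2) : geoDist x x = 0 := by
  simp [geoDist]

lemma geoDist_pos {x y : S2} (h : x ≠ y) : 0 < geoDist x y := by
  refine Real.arccos_pos.2 (lt_of_le_of_ne ?_ fun h1 => h (Subtype.ext ?_))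
  · simpa using real_inner_le_norm (x : EuclideanSpace ℝ (Fin 3)) y
  · exact (inner_eq_one_iff_of_norm_eq_one (by simp) (by simp)).1 h1

lemma isOpen_geoBall (x : S2) (ε : ℝ) : IsOpen (geoBall x ε) :=
  isOpen_lt (continuous_geoDist x) continuous_const

lemma frontier_geoBall_subset (x : S2) (ε : ℝ) :
    frontier (geoBall x ε) ⊆ {y | geoDist y x = ε} :=
  frontier_lt_subset_eq (continuous_geoDist x) continuous_const

lemma exists_radius_separating {M : ℕ} {x : Fin M → S2} (hx : Function.Injective x) :
    ∃ ε : ℝ, 0 < ε ∧ ∀ i j, i ≠ j → ε < geoDist (x j) (x i) := by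
  have h : ∀ᶠ ε in 𝓝[>] (0 : ℝ), ∀ i j, i ≠ j → ε < geoDist (x j) (x i) := by
    refine eventually_all.2 fun i => eventually_all.2 fun j => ?_
    by_cases hij : i = j
    · simp [hij]
    · filter_upwards [nhdsWithin_le_nhds (eventually_lt_nhds (geoDist_pos (hx.ne (Ne.symm hij))))]
        with ε hε _ using hε
  obtain ⟨ε, h1, h2⟩ := (h.and self_mem_nhdsWithin).exists
  exact ⟨ε, h2, h1⟩

end

end SphereSuperRes

/-! ### Convergence of the grid solutions -/

theorem mainTheorem4 (N M : ℕ) (c : Fin M → ℝ) (x : Fin M → SphereSuperRes.S2)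
    (hx : Function.Injective x)
    (hsol : SphereSuperRes.IsSolution N (SphereSuperRes.spikes c x) (SphereSuperRes.spikes c x))
    (huniq : ∀ ν : SignedMeasure SphereSuperRes.S2,
      SphereSuperRes.IsSolution N (SphereSuperRes.spikes c x) ν → ν = SphereSuperRes.spikes c x)
    (G : ℕ → Set SphereSuperRes.S2) (hG : ∀ n, IsDiscrete (G n))
    (hfill : Tendsto (fun n => SphereSuperRes.fillDist (G n)) atTop (𝓝 0)) :
    (∀ μ : ℕ → SignedMeasure SphereSuperRes.S2,
      (∀ᶠ n in atTop, SphereSuperRes.IsSolutionOn N (SphereSuperRes.spikes c x) (G n) (μ n)) →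
      SphereSuperRes.WeakStarTendsto μ (SphereSuperRes.spikes c x)) ∧
    ∃ ε : ℝ, 0 < ε ∧
      ∀ μ : ℕ → SignedMeasure SphereSuperRes.S2,
        (∀ᶠ n in atTop, SphereSuperRes.IsSolutionOn N (SphereSuperRes.spikes c x) (G n) (μ n)) →
        (∀ i, Tendsto (fun n => (μ n) (SphereSuperRes.geoBall (x i) ε)) atTop (𝓝 (c i))) ∧
        (∀ i, Tendsto (fun n => (μ n).variation (SphereSuperRes.geoBall (x i) ε)) atTop
          (𝓝 (ENNReal.ofReal |c i|))) ∧
        Tendsto (fun n => (μ n).variation (⋃ i, SphereSuperRes.geoBall (x i) ε)ᶜ) atTop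
          (𝓝 0) := by
  classical
  open SphereSuperRes in
  constructor
  · intro μ hμ f
    obtain ⟨hpos, hneg⟩ := tendsto_jordan_of_isSolutionOn hx hsol huniq hfill hμ
    simp_rw [integral_eq_posFinite_sub_negFinite]
    exact (FiniteMeasure.tendsto_iff_forall_integral_tendsto.1 hpos
      (BoundedContinuousFunction.mkOfCompact f)).sub
      (FiniteMeasure.tendsto_iff_forall_integral_tendsto.1 hneg
      (BoundedContinuousFunction.mkOfCompact f))
  obtain ⟨ε, hε, hsep⟩ := exists_radius_separating hx
  refine ⟨ε, hε, fun μ hμ => ?_⟩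
  obtain ⟨hpos, hneg⟩ := tendsto_jordan_of_isSolutionOn hx hsol huniq hfill hμ
  set t := spikes c x with ht
  have hnull : ∀ E : Set S2, MeasurableSet E → (∀ j, x j ∉ E) → t.variation E = 0 := by
    intro E hE hxE
    rw [ht, variation_spikes c hx]
    simp [Measure.finsetSum_apply, hE, hxE]
  have hvar : ∀ E : Set S2, MeasurableSet E → t.variation (frontier E) = 0 →
      Tendsto (fun n => (μ n) E) atTop (𝓝 (t E)) ∧
        Tendsto (fun n => (μ n).variation E) atTop (𝓝 (t.variation E)) := by
    intro E hE h0
    rw [variation_eq_posFinite_add_negFinite, Measure.add_apply, add_eq_zero] at h0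
    have h1 := tendsto_measure_of_null_frontier_of_tendsto hpos h0.1
    have h2 := tendsto_measure_of_null_frontier_of_tendsto hneg h0.2
    constructor
    · simp_rw [SignedMeasure.apply_eq_posPart_real_sub_negPart_real _ hE]
      exact ((ENNReal.tendsto_toReal (measure_ne_top _ _)).comp h1).sub
        ((ENNReal.tendsto_toReal (measure_ne_top _ _)).comp h2)
    · simp_rw [variation_eq_posFinite_add_negFinite, Measure.add_apply]
      exact h1.add h2
  have hmem : ∀ i j, x j ∈ geoBall (x i) ε ↔ j = i := by
    intro i j
    refine ⟨fun h => ?_, ?_⟩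
    · by_contra hij
      exact absurd h (hsep i j (Ne.symm hij)).not_gt
    · rintro rfl
      exact (geoDist_self (x j)).trans_lt hε
  have hball : ∀ i, t.variation (frontier (geoBall (x i) ε)) = 0 := by
    refine fun i => hnull _ isClosed_frontier.measurableSet fun j hj => ?_
    have h1 : geoDist (x j) (x i) = ε := frontier_geoBall_subset _ _ hj
    by_cases hij : i = j
    · rw [hij, geoDist_self] at h1
      exact hε.ne h1
    · exact (hsep i j hij).ne' h1
  have hmeas : ∀ i, MeasurableSet (geoBall (x i) ε) := fun i =>
    (isOpen_geoBall _ _).measurableSet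
  refine ⟨fun i => ?_, fun i => ?_, ?_⟩
  · have h := (hvar _ (hmeas i) (hball i)).1
    have hval : t (geoBall (x i) ε) = c i := by
      simp [ht, spikes_apply c x (hmeas i), hmem]
    rwa [hval] at h
  · have h := (hvar _ (hmeas i) (hball i)).2
    have hval : t.variation (geoBall (x i) ε) = ENNReal.ofReal |c i| := by
      rw [ht, variation_spikes c hx, ← Real.enorm_eq_ofReal_abs]
      simp [Measure.finsetSum_apply, hmeas i, Set.indicator_apply, hmem]
    rwa [hval] at h
  · -- A closed set contains its frontier, and no spike lies in this one.
    have hopen : IsOpen (⋃ i, geoBall (x i) ε) := isOpen_iUnion fun i => isOpen_geoBall _ _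
    have hout := hnull _ hopen.measurableSet.compl fun j hj =>
      hj (Set.mem_iUnion.2 ⟨j, (hmem j j).2 rfl⟩)
    have h := (hvar _ hopen.measurableSet.compl
      (measure_mono_null hopen.isClosed_compl.frontier_subset hout)).2
    rwa [hout] at h
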